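/- Let $F:\mathbb R^n\to\mathbb R^n$ and $g:\mathbb R^n\to\mathbb R^m$ be continuously differentiable, let $h(x)=Hx-c$ with $H\in\mathbb R^{k\times n}$, $c\in\mathbb R^k$, and let $\mathcal C=\{x\in\mathbb R^n : g(x)\le 0,\ h(x)=0\}$ be convex. Write $\mathrm{SOL}(F,\mathcal C)=\{x^*\in\mathcal C : (x-x^*)^\top F(x^*)\ge 0\ \ \forall x\in\mathcal C\}$ and assume $\mathrm{SOL}(F,\mathcal C)\ne\emptyset$. Suppose that the Mangasarian–Fromovitz constraint qualification (MFCQ) holds at every $x\in\mathcal C$: the gradients $\nabla h_1(x),\dots,\nabla h_k(x)$ are linearly independent, and there is $\xi\in\mathbb R^n$ with $\nabla g_i(x)^\top\xi<0$ for all $i$ with $g_i(x)=0$ and $\nabla h_j(x)^\top\xi=0$ for all $j$. For $x\in\mathbb R^n$ let $N_{\mathcal C}(x)=\{d: d^\top(x'-x)\le 0\ \ \forall x'\in\mathcal C\}$ and $T_{\mathcal C}(x)=\{\xi: d^\top\xi\le 0\ \ \forall d\in N_{\mathcal C}(x)\}$. The projected monotone flow is $$\dot x=\mathrm{proj}_{T_{\mathcal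 C}(x)}(-F(x)),$$ where $\mathrm{proj}$ is the Euclidean projection. Its solutions are the Carathéodory solutions on an interval $J\subseteq[0,\infty)$ with $0\in J$: (locally) absolutely continuous functions that satisfy the equation at almost every $t\in J$. An equilibrium is a point $x^*\in\mathcal C$ with $\mathrm{proj}_{T_{\mathcal C}(x^*)}(-F(x^*))=0$. From every $x_0\in\mathcal C$ there starts a solution on some interval $[0,T)$ with $T>0$; two solutions on the same interval with the same initial point in $\mathcal C$ coincide; and if $F$ is monotone, i.e. $(x_1-x_2)^\top(F(x_1)-F(x_2))\ge0$ for all $x_1,x_2\in\mathbb R^n$, then from every $x_0\in\mathcal C$ there starts a solution on $[0,\infty)$. Moreover: 1. $\mathcal C$ is forward invariant: every solution $x:J\to\mathbb R^n$ with $x(0)\in\mathcal C$ satisfies $x(t)\in\mathcal C$ for all $t\in J$. 2. $x^*$ is an equilibrium if and only if $x^*\in\mathrm{SOL}(F,\mathcal C)$. 3. If $x^*\in\mathrm{SOL}(F,\mathcal C)$ and $F$ is monotone, then $x^*$ is globally Lyapunov stable relative to $\mathcal C$: for every $\varepsilon>0$ there is $\delta>0$ such that every solution with $x(0)\in\mathcal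 C$, $\|x(0)-x^*\|<\delta$ satisfies $\|x(t)-x^*\|<\varepsilon$ for all $t\in J$; and for every $\delta>0$ there is $\varepsilon>0$ with the same property. 4. If $F$ is $\mu$-strongly monotone, i.e. $\mu>0$ and $(x_1-x_2)^\top(F(x_1)-F(x_2))\ge\mu\|x_1-x_2\|^2$ for all $x_1,x_2\in\mathbb R^n$, then the flow is contracting at rate $\mu$: any two solutions $x,y$ on the same interval $J$ with $x(0),y(0)\in\mathcal C$ satisfy $\|x(t)-y(t)\|\le e^{-\mu t}\|x(0)-y(0)\|$ for all $t\in J$. In particular $\mathrm{SOL}(F,\mathcal C)=\{x^*\}$ is a singleton and $x^*$ is globally exponentially stable relative to $\mathcal C$, with rate $\mu$: there is $M>0$ such that every solution with $x(0)\in\mathcal C$ satisfies $\|x(t)-x^*\|\le M e^{-\mu t}\|x(0)-x^*\|$ for all $t\in J$. -/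

import Mathlib

open MeasureTheory Set

noncomputable section

namespace ProjFlow

/-- `ℝⁿ` with the Euclidean norm. -/
abbrev E (n : ℕ) := EuclideanSpace ℝ (Fin n)

/-- The metric projection onto the closure of `C` (a set-valued map). -/
def proj {n : ℕ} (C : Set (E n)) (x : E n) : Set (E n) :=
  {y | y ∈ closure C ∧ ‖x - y‖ = Metric.infDist x C}

/-- The normal cone `N_C(x)`, for every `x ∈ ℝⁿ`. -/
def normalCone {n : ℕ} (C : Set (E n)) (x : E n) : Set (E n) :=
  {d | ∀ x' ∈ C, inner ℝ d (x' - x) ≤ 0}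

/-- The tangent cone `T_C(x)`, the polar of the normal cone. -/
def tangentCone {n : ℕ} (C : Set (E n)) (x : E n) : Set (E n) :=
  {ξ | ∀ d ∈ normalCone C x, inner ℝ d ξ ≤ 0}

/-- The solution set `SOL(F, C)` of the variational inequality `VI(F, C)`. -/
def SOL {n : ℕ} (F : E n → E n) (C : Set (E n)) : Set (E n) :=
  {xs | xs ∈ C ∧ ∀ x ∈ C, 0 ≤ inner ℝ (x - xs) (F xs)}

/-- `F` is monotone on `ℝⁿ` (in the sense of operators). -/
def MonotoneMap {n : ℕ} (F : E n → E n) : Prop :=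
  ∀ x₁ x₂, 0 ≤ inner ℝ (x₁ - x₂) (F x₁ - F x₂)

/-- `F` is `μ`-strongly monotone on `ℝⁿ`. -/
def StronglyMonotoneMap {n : ℕ} (μ : ℝ) (F : E n → E n) : Prop :=
  0 < μ ∧ ∀ x₁ x₂, μ * ‖x₁ - x₂‖ ^ 2 ≤ inner ℝ (x₁ - x₂) (F x₁ - F x₂)

/-- The affine map `h(x) = H x - c`. -/
def affineConstraint {n k : ℕ} (H : Matrix (Fin k) (Fin n) ℝ) (c : E k) (x : E n) : E k :=
  WithLp.toLp 2 (H.mulVec x.ofLp) - c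

/-- The constraint set `{x | g(x) ≤ 0, h(x) = 0}`. -/
def constraintSet {n m k : ℕ} (g : E n → E m) (h : E n → E k) : Set (E n) :=
  {x | (∀ i, g x i ≤ 0) ∧ h x = 0}

/-- The Mangasarian-Fromovitz constraint qualification at `x`. -/
def MFCQ {n m k : ℕ} (g : E n → E m) (h : E n → E k) (x : E n) : Prop :=
  LinearIndependent ℝ (fun j : Fin k => gradient (fun y => h y j) x) ∧
  ∃ ξ : E n,
    (∀ i, g x i = 0 → inner ℝ (gradient (fun y => g y i) x) ξ < 0) ∧
    (∀ j, inner ℝ (gradient (fun y => h y j) x) ξ = 0)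

/-- `x` is a Carathéodory solution, on the interval `J` with left end point `0 ∈ J`, of the
projected monotone flow `ẋ = proj_{T_C(x)}(-F(x))`. The values of `x` off `J` are irrelevant. -/
structure IsSolution {n : ℕ} (F : E n → E n) (C : Set (E n)) (J : Set ℝ) (x : ℝ → E n) :
    Prop where
  ordConnected : J.OrdConnected
  isLeast : IsLeast J 0
  absolutelyContinuous : ∀ b ∈ J, AbsolutelyContinuousOnInterval x 0 b
  ode : ∀ᵐ t, t ∈ J → ∃ v ∈ proj (tangentCone C (x t)) (-F (x t)), HasDerivAt x v t

/-- Every solution that starts in `C` stays in `C` as long as it exists. -/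
def ForwardInvariant {n : ℕ} (F : E n → E n) (C : Set (E n)) : Prop :=
  ∀ (J : Set ℝ) (x : ℝ → E n), IsSolution F C J x → x 0 ∈ C → ∀ t ∈ J, x t ∈ C

/-- `xs ∈ C` is a zero of the right-hand side of the projected monotone flow on `C`. -/
def IsEquilibrium {n : ℕ} (F : E n → E n) (C : Set (E n)) (xs : E n) : Prop :=
  xs ∈ C ∧ 0 ∈ proj (tangentCone C xs) (-F xs)

/-- Global Lyapunov stability relative to `C`: solutions that start in `C` close to `xs` stay close
to `xs`, and those that start in `C` within any given distance of `xs` stay within a uniform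
distance of it. -/
def GloballyLyapunovStable {n : ℕ} (F : E n → E n) (C : Set (E n)) (xs : E n) : Prop :=
  (∀ ε > 0, ∃ δ > 0, ∀ (J : Set ℝ) (x : ℝ → E n), IsSolution F C J x → x 0 ∈ C →
    ‖x 0 - xs‖ < δ → ∀ t ∈ J, ‖x t - xs‖ < ε) ∧
  (∀ δ > 0, ∃ ε > 0, ∀ (J : Set ℝ) (x : ℝ → E n), IsSolution F C J x → x 0 ∈ C →
    ‖x 0 - xs‖ < δ → ∀ t ∈ J, ‖x t - xs‖ < ε)

/-- The flow on `C` is contracting at rate `c` in the Euclidean norm. -/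
def Contracting {n : ℕ} (F : E n → E n) (C : Set (E n)) (c : ℝ) : Prop :=
  ∀ (J : Set ℝ) (x y : ℝ → E n), IsSolution F C J x → IsSolution F C J y → x 0 ∈ C → y 0 ∈ C →
    ∀ t ∈ J, ‖x t - y t‖ ≤ Real.exp (-c * t) * ‖x 0 - y 0‖

/-- Global exponential stability of `xs` relative to `C`, with rate `c`. -/
def GloballyExponentiallyStable {n : ℕ} (F : E n → E n) (C : Set (E n)) (xs : E n) (c : ℝ) :
    Prop :=
  0 < c ∧ ∃ M > 0, ∀ (J : Set ℝ) (x : ℝ → E n), IsSolution F C J x → x 0 ∈ C →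
    ∀ t ∈ J, ‖x t - xs‖ ≤ M * Real.exp (-c * t) * ‖x 0 - xs‖

/-- From every point of `C` there starts a solution on a nondegenerate interval, and two solutions
on a common interval with the same initial point in `C` coincide. -/
def WellPosed {n : ℕ} (F : E n → E n) (C : Set (E n)) : Prop :=
  (∀ x₀ ∈ C, ∃ T > 0, ∃ x : ℝ → E n, IsSolution F C (Ico 0 T) x ∧ x 0 = x₀) ∧
  (∀ (J : Set ℝ) (x y : ℝ → E n), IsSolution F C J x → IsSolution F C J y → x 0 ∈ C →
    x 0 = y 0 → ∀ t ∈ J, x t = y t)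

/-- From every point of `C` there starts a solution on `[0, ∞)`. -/
def GloballySolvable {n : ℕ} (F : E n → E n) (C : Set (E n)) : Prop :=
  ∀ x₀ ∈ C, ∃ x : ℝ → E n, IsSolution F C (Ici 0) x ∧ x 0 = x₀

end ProjFlow

end

/-! `C` is closed and convex, and everything rests on monotonicity of its normal cone. If `v` is the
projection of `-F x` onto the tangent cone at `x`, then `-F x - v` lies in the normal cone
(`inner_sub_nonpos_of_mem_proj_tangentCone`). Adding this relation for two solutions in `C`, each
tested against the other, gives half the derivative of `‖x - y‖ ^ 2` at most `-⟪x - y, F x - F y⟫`.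
Gronwall (`IsSolution.norm_sub_le`) then yields uniqueness from a local Lipschitz constant,
contraction from strong monotonicity, and stability by comparison with the constant solution at a
point of `SOL F C`.

Invariance holds because the squared distance to `C` cannot increase: the vector from the nearest
point of `C` is itself a normal.

For existence, the projected Euler scheme runs in `C` cut by a ball. Its limit satisfies an
evolution variational inequality (`exists_lipschitz_variational_solution`), which is the projected
equation as long as the curve stays inside the ball. Monotonicity keeps it inside a ball around a
point of `SOL F C` for all time. -/

open Filter Topology
open scoped NNReal

namespace ProjFlow

/-! ### Differential inequalities for absolutely continuous functions. -/

section AbsolutelyContinuous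

theorem absolutelyContinuousOnInterval_comp {X Y : Type*} [PseudoMetricSpace X]
    [PseudoMetricSpace Y] {φ : X → Y} (hφ : LipschitzWith 1 φ) {f : ℝ → X} {a b : ℝ}
    (hf : AbsolutelyContinuousOnInterval f a b) :
    AbsolutelyContinuousOnInterval (fun t => φ (f t)) a b := by
  rw [absolutelyContinuousOnInterval_iff] at hf ⊢
  intro ε hε
  obtain ⟨δ, hδ, h⟩ := hf ε hε
  refine ⟨δ, hδ, fun I hI hlt => lt_of_le_of_lt (Finset.sum_le_sum fun i _ => ?_) (h I hI hlt)⟩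
  simpa using hφ.dist_le_mul (f (I.2 i).1) (f (I.2 i).2)

/-- An absolutely continuous function whose derivative is almost everywhere nonpositive does not
increase. -/
theorem le_of_ae_hasDerivAt_nonpos {f : ℝ → ℝ} {a b : ℝ} (hab : a ≤ b)
    (hf : AbsolutelyContinuousOnInterval f a b)
    (h : ∀ᵐ t, t ∈ Icc a b → ∀ f', HasDerivAt f f' t → f' ≤ 0) : f b ≤ f a := by
  have hle : ∫ t in a..b, deriv f t ≤ ∫ _ in a..b, (0 : ℝ) := by
    refine intervalIntegral.integral_mono_ae_restrict hab hf.intervalIntegrable_deriv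
      intervalIntegrable_const ?_
    rw [EventuallyLE, ae_restrict_iff' measurableSet_Icc]
    filter_upwards [h] with t ht htI
    by_cases hd : DifferentiableAt ℝ f t
    · exact ht htI _ hd.hasDerivAt
    -- Here `deriv` takes its default value `0`, which also respects the bound.
    · simp [deriv_zero_of_not_differentiableAt hd]
  rw [hf.integral_deriv_eq_sub] at hle
  simpa using hle

/-- Gronwall's inequality for absolutely continuous functions. -/
theorem le_exp_mul_of_ae_hasDerivAt_le {f : ℝ → ℝ} {κ b : ℝ} (hb : 0 ≤ b)
    (hf : AbsolutelyContinuousOnInterval f 0 b)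
    (h : ∀ᵐ t, t ∈ Icc 0 b → ∃ f', HasDerivAt f f' t ∧ f' ≤ -κ * f t) :
    f b ≤ Real.exp (-κ * b) * f 0 := by
  have hexp : AbsolutelyContinuousOnInterval (fun t => Real.exp (κ * t)) 0 b := by
    refine ContDiffOn.absolutelyContinuousOnInterval (ContDiff.contDiffOn ?_)
    fun_prop
  -- The integrating factor makes the product nonincreasing.
  have key : Real.exp (κ * b) * f b ≤ Real.exp (κ * 0) * f 0 := by
    refine le_of_ae_hasDerivAt_nonpos hb (hexp.fun_mul hf) ?_
    filter_upwards [h] with t ht htI g' hg'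
    obtain ⟨f', hf', hle⟩ := ht htI
    have hE : HasDerivAt (fun t => Real.exp (κ * t)) (Real.exp (κ * t) * (κ * 1)) t :=
      ((hasDerivAt_id t).const_mul κ).exp
    rw [hg'.unique (hE.mul hf')]
    have := mul_le_mul_of_nonneg_left hle (Real.exp_pos (κ * t)).le
    linarith
  rw [mul_zero, Real.exp_zero, one_mul] at key
  calc f b = Real.exp (-κ * b) * (Real.exp (κ * b) * f b) := by
        rw [← mul_assoc, ← Real.exp_add]; simp
    _ ≤ _ := mul_le_mul_of_nonneg_left key (Real.exp_pos _).le

end AbsolutelyContinuous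

/-! ### The projected Euler scheme and its limit. -/

section Euler

theorem natFloor_sub_natFloor_le {a b : ℝ} (hab : a ≤ b) :
    (⌊b⌋₊ : ℝ) - ⌊a⌋₊ ≤ b - a + 1 := by
  have ha := Nat.lt_floor_add_one a
  rcases le_total 0 b with hb | hb
  · linarith [Nat.floor_le hb]
  · rw [Nat.floor_of_nonpos hb, Nat.floor_of_nonpos (hab.trans hb)]
    simp only [Nat.cast_zero]; linarith

theorem le_add_mul_of_forall_succ_le {f : ℕ → ℝ} {a : ℝ} {i j : ℕ} (hij : i ≤ j)
    (h : ∀ k, i ≤ k → k < j → f (k + 1) ≤ f k + a) : f j ≤ f i + (j - i) * a := by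
  induction j, hij using Nat.le_induction with
  | base => simp
  | succ j hij ih =>
    have h1 := ih fun k hk hkj => h k hk (hkj.trans (Nat.lt_succ_self j))
    have h2 := h j hij (Nat.lt_succ_self j)
    push_cast
    linarith

theorem dist_le_mul_of_forall_succ_le {V : Type*} [PseudoMetricSpace V] {u : ℕ → V} {a : ℝ}
    (h : ∀ k, dist (u k) (u (k + 1)) ≤ a) {i j : ℕ} (hij : i ≤ j) :
    dist (u i) (u j) ≤ (j - i) * a := by
  have := le_add_mul_of_forall_succ_le (f := fun k => dist (u i) (u k)) hij
    fun k _ _ => (dist_triangle _ _ _).trans (add_le_add_right (h k) _)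
  simpa using this

variable {V : Type*} [NormedAddCommGroup V] [InnerProductSpace ℝ V]

theorem hasDerivAt_norm_sub_sq {x y : ℝ → V} {v w : V} {t : ℝ} (hx : HasDerivAt x v t)
    (hy : HasDerivAt y w t) :
    HasDerivAt (fun s => ‖x s - y s‖ ^ 2) (2 * inner ℝ (x t - y t) (v - w)) t :=
  (hx.sub hy).norm_sq

/-- The projected Euler scheme with step size `h`. -/
theorem exists_projected_euler {K : Set V} (hK : IsCompact K) (hconv : Convex ℝ K) {F : V → V}
    {x₀ : V} (hx₀ : x₀ ∈ K) {M : ℝ} (hM : ∀ x ∈ K, ‖F x‖ ≤ M) {h : ℝ} (hh : 0 ≤ h) :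
    ∃ u : ℕ → V, u 0 = x₀ ∧ (∀ k, u k ∈ K) ∧ (∀ k, dist (u k) (u (k + 1)) ≤ h * M) ∧
      ∀ z ∈ K, ∀ k, ‖u (k + 1) - z‖ ^ 2 ≤
        ‖u k - z‖ ^ 2 + 2 * h * inner ℝ (F (u k)) (z - u (k + 1)) := by
  have hp : ∀ u : V, ∃ v ∈ K, ∀ w ∈ K, inner ℝ (u - v) (w - v) ≤ 0 := fun u => by
    obtain ⟨v, hv, he⟩ := exists_norm_eq_iInf_of_complete_convex ⟨x₀, hx₀⟩ hK.isComplete hconv u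
    exact ⟨v, hv, (norm_eq_iInf_iff_real_inner_le_zero hconv hv).1 he⟩
  choose p hpK hp using hp
  let u : ℕ → V := fun k => Nat.rec x₀ (fun _ y => p (y - h • F y)) k
  have hu : ∀ k, u (k + 1) = p (u k - h • F (u k)) := fun k => rfl
  have huK : ∀ k, u k ∈ K := fun k => by
    cases k with
    | zero => exact hx₀
    | succ k => rw [hu]; exact hpK _
  have hvar : ∀ k, ∀ z ∈ K, inner ℝ (u k - h • F (u k) - u (k + 1)) (z - u (k + 1)) ≤ 0 :=
    fun k z hz => by rw [hu]; exact hp _ z hz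
  refine ⟨u, rfl, huK, fun k => ?_, fun z hz k => ?_⟩
  -- Testing with `u k` gives `‖u k - u (k + 1)‖ ^ 2 ≤ h * M * ‖u k - u (k + 1)‖`; one factor is
  -- then cancelled.
  · have h1 := hvar k (u k) (huK k)
    rw [sub_right_comm, inner_sub_left, real_inner_self_eq_norm_sq, real_inner_smul_left] at h1
    have h2 := real_inner_le_norm (F (u k)) (u k - u (k + 1))
    have h3 := mul_le_mul_of_nonneg_right (hM _ (huK k)) (norm_nonneg (u k - u (k + 1)))
    have h4 := mul_le_mul_of_nonneg_left (h2.trans h3) hh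
    rw [dist_eq_norm]
    have hM0 : 0 ≤ M := (norm_nonneg _).trans (hM _ hx₀)
    have hnn := norm_nonneg (u k - u (k + 1))
    by_contra! hlt
    have := mul_lt_mul_of_pos_right hlt ((mul_nonneg hh hM0).trans_lt hlt)
    nlinarith
  · have h1 := hvar k z hz
    have h2 : u k - z = (u k - u (k + 1)) + (u (k + 1) - z) := by abel
    have h3 := norm_add_sq_real (u k - u (k + 1)) (u (k + 1) - z)
    rw [← h2] at h3
    rw [sub_right_comm, inner_sub_left, real_inner_smul_left] at h1
    have h4 : inner ℝ (u k - u (k + 1)) (z - u (k + 1))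
        = - inner ℝ (u k - u (k + 1)) (u (k + 1) - z) := by
      rw [← inner_neg_right, neg_sub]
    nlinarith [sq_nonneg ‖u k - u (k + 1)‖]

/-- Limits of the projected Euler scheme in a compact convex set solve the evolution variational
inequality. -/
theorem exists_lipschitz_variational_solution {K : Set V} (hK : IsCompact K)
    (hconv : Convex ℝ K) {F : V → V} (hF : Continuous F) {x₀ : V} (hx₀ : x₀ ∈ K) {M : ℝ≥0}
    (hM : ∀ x ∈ K, ‖F x‖ ≤ M) :
    ∃ x : ℝ → V, LipschitzWith M x ∧ x 0 = x₀ ∧ (∀ t, x t ∈ K) ∧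
      ∀ s, 0 ≤ s → ∀ v, HasDerivAt x v s → ∀ z ∈ K, 0 ≤ inner ℝ (v + F (x s)) (z - x s) := by
  have hN : ∀ n : ℕ, (0 : ℝ) < n + 1 := fun n => by positivity
  choose u hu0 huK hdist hen using fun n : ℕ =>
    exists_projected_euler hK hconv hx₀ hM (h := ((n : ℝ) + 1)⁻¹) (inv_nonneg.2 (hN n).le)
  -- Number of steps of length `1 / (n + 1)` taken by time `t`; it is `0` for negative `t`, so the
  -- limit curve is defined on all of `ℝ`.
  let j : ℕ → ℝ → ℕ := fun n t => ⌊t * ((n : ℝ) + 1)⌋₊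
  have hjmono : ∀ n {s t : ℝ}, s ≤ t → j n s ≤ j n t := fun n s t hst =>
    Nat.floor_mono (mul_le_mul_of_nonneg_right hst (hN n).le)
  have hj : ∀ n {s t : ℝ}, s ≤ t →
      ((j n t : ℝ) - j n s) * ((n : ℝ) + 1)⁻¹ ≤ t - s + ((n : ℝ) + 1)⁻¹ := fun n s t hst => by
    have := natFloor_sub_natFloor_le (mul_le_mul_of_nonneg_right hst (hN n).le)
    calc _ ≤ (t * ((n : ℝ) + 1) - s * (n + 1) + 1) * ((n : ℝ) + 1)⁻¹ :=
          mul_le_mul_of_nonneg_right this (inv_nonneg.2 (hN n).le)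
      _ = _ := by have := (hN n).ne'; field_simp
  have hatTop : Tendsto (fun n : ℕ => (n : ℝ) + 1) (hyperfilter ℕ) atTop :=
    (tendsto_atTop_add_const_right _ _ tendsto_natCast_atTop_atTop).mono_left
      Nat.hyperfilter_le_atTop
  have hinv : Tendsto (fun n : ℕ => ((n : ℝ) + 1)⁻¹) (hyperfilter ℕ) (𝓝 0) :=
    tendsto_inv_atTop_zero.comp hatTop
  have hjlim : ∀ t, 0 ≤ t →
      Tendsto (fun n : ℕ => (j n t : ℝ) * ((n : ℝ) + 1)⁻¹) (hyperfilter ℕ) (𝓝 t) :=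
    fun t ht => (tendsto_nat_floor_mul_div_atTop ht).comp hatTop
  -- Along an ultrafilter, compactness gives limits at all times at once, without extracting
  -- subsequences.
  have hlim : ∀ t, ∃ y ∈ K, Tendsto (fun n => u n (j n t)) (hyperfilter ℕ) (𝓝 y) := fun t =>
    isCompact_iff_ultrafilter_le_nhds.1 hK ((hyperfilter ℕ).map fun n => u n (j n t))
      (le_principal_iff.2 (show ∀ᶠ n in hyperfilter ℕ, u n (j n t) ∈ K from
        .of_forall fun n => huK n _))
  choose x hxK hx using hlim
  have hud : ∀ n {i l : ℕ}, i ≤ l → dist (u n i) (u n l) ≤ (l - i) * ((n : ℝ) + 1)⁻¹ * M :=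
    fun n i l hil => by
      rw [mul_assoc]; exact dist_le_mul_of_forall_succ_le (hdist n) hil
  refine ⟨x, ?_, ?_, hxK, ?_⟩
  · refine LipschitzWith.of_dist_le_mul fun s t => ?_
    wlog hst : s ≤ t generalizing s t
    · rw [dist_comm, dist_comm s]; exact this t s (le_of_not_ge hst)
    have h1 : Tendsto (fun n : ℕ => (t - s + ((n : ℝ) + 1)⁻¹) * M) (hyperfilter ℕ)
        (𝓝 ((t - s + 0) * M)) := (hinv.const_add _).mul_const _
    have h2 := le_of_tendsto_of_tendsto' ((hx s).dist (hx t)) h1 fun n =>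
      (hud n (hjmono n hst)).trans (mul_le_mul_of_nonneg_right (hj n hst) M.2)
    rwa [dist_comm s, Real.dist_eq, abs_of_nonneg (sub_nonneg.2 hst), mul_comm, ← add_zero (t - s)]
  · refine tendsto_nhds_unique (hx 0) ?_
    simp [j, hu0]
  · intro s hs v hv z hz
    set φ := inner ℝ (F (x s)) (z - x s) with hφ
    suffices hsuff : inner ℝ (x s - z) v ≤ φ by
      rw [inner_add_left, ← neg_sub (x s) z, inner_neg_right, real_inner_comm]
      rw [neg_sub, ← hφ]; linarith
    refine le_of_forall_pos_le_add fun ε hε => ?_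
    have hcont : Continuous fun q : V × V => inner ℝ (F q.1) (z - q.2) := by fun_prop
    obtain ⟨δ, hδ, hball⟩ := Metric.eventually_nhds_iff_ball.1
      (hcont.continuousAt.eventually_lt_const
        (show inner ℝ (F (x s, x s).1) (z - (x s, x s).2) < φ + ε by simp [← hφ, hε]))
    -- The left side is the limit in `n` of the quantity in `hev`, which bounds the distance to `x
    -- s` of all Euler points between times `s` and `t`.
    have hη : ∀ᶠ t in 𝓝[>] s, (t - s + 0) * (M : ℝ) + dist (x s) (x s) < δ := by
      have : Tendsto (fun t => (t - s + 0) * (M : ℝ) + dist (x s) (x s)) (𝓝[>] s)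
          (𝓝 ((s - s + 0) * (M : ℝ) + dist (x s) (x s))) :=
        (Continuous.tendsto (by fun_prop) s).mono_left nhdsWithin_le_nhds
      exact this.eventually_lt_const (by simpa using hδ)
    -- Obtained by summing the one-step energy estimates from `s` to `t` and passing to the limit;
    -- its right difference quotient gives the bound on `v`.
    have hclaim : ∀ᶠ t in 𝓝[>] s, ‖x t - z‖ ^ 2 ≤ ‖x s - z‖ ^ 2 + (t - s) * (2 * (φ + ε)) := by
      filter_upwards [hη, self_mem_nhdsWithin] with t ht hst
      have hst : s ≤ t := le_of_lt hst
      have hev : ∀ᶠ n : ℕ in hyperfilter ℕ,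
          (t - s + ((n : ℝ) + 1)⁻¹) * M + dist (u n (j n s)) (x s) < δ :=
        (((hinv.const_add _).mul_const _).add ((hx s).dist tendsto_const_nhds)).eventually_lt_const
          ht
      have h1 := (((hx s).sub_const z).norm.pow 2).add
        (((hjlim t (hs.trans hst)).sub (hjlim s hs)).mul_const (2 * (φ + ε)))
      refine le_of_tendsto_of_tendsto (((hx t).sub_const z).norm.pow 2) h1 ?_
      filter_upwards [hev] with n hn
      have hnear : ∀ k, j n s ≤ k → k ≤ j n t → dist (u n k) (x s) < δ := fun k h1 h2 => by
        refine lt_of_le_of_lt ((dist_triangle_left _ _ (u n (j n s))).trans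
          (add_le_add_left ?_ _)) hn
        refine (hud n h1).trans (mul_le_mul_of_nonneg_right (le_trans ?_ (hj n hst)) M.2)
        exact mul_le_mul_of_nonneg_right (by gcongr) (inv_nonneg.2 (hN n).le)
      have := le_add_mul_of_forall_succ_le (f := fun k => ‖u n k - z‖ ^ 2)
        (a := 2 * ((n : ℝ) + 1)⁻¹ * (φ + ε)) (hjmono n hst) fun k h1 h2 => by
          refine (hen n z hz k).trans (add_le_add_right ?_ _)
          refine mul_le_mul_of_nonneg_left (hball (u n k, u n (k + 1)) ?_).le
            (mul_nonneg zero_le_two (inv_nonneg.2 (hN n).le))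
          rw [Metric.mem_ball, Prod.dist_eq]
          exact max_lt (hnear k h1 h2.le) (hnear (k + 1) (h1.trans (Nat.le_succ k)) h2)
      refine this.trans_eq ?_
      ring
    have hder := hasDerivAt_norm_sub_sq hv (hasDerivAt_const s z)
    have hslope := (hasDerivAt_iff_tendsto_slope.1 hder).mono_left
      (nhdsWithin_mono s (show Ioi s ⊆ {s}ᶜ from fun t ht => ht.ne'))
    have hle : 2 * inner ℝ (x s - z) (v - 0) ≤ 2 * (φ + ε) := by
      refine le_of_tendsto hslope ?_
      filter_upwards [hclaim, self_mem_nhdsWithin] with t ht hst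
      have hpos : 0 < t - s := sub_pos.2 hst
      rw [slope_def_field, div_le_iff₀ hpos]
      linarith
    rw [sub_zero] at hle
    linarith

end Euler

end ProjFlow

namespace ProjFlow

variable {n : ℕ} {F : E n → E n} {C : Set (E n)}

/-! ### Projection onto the tangent cone, and equilibria. -/

section Cones

theorem sub_mem_tangentCone {x y : E n} (hy : y ∈ C) : y - x ∈ tangentCone C x :=
  fun _ hd => hd y hy

theorem zero_mem_tangentCone (x : E n) : 0 ∈ tangentCone C x := fun d _ => by simp

theorem add_mem_tangentCone {x ξ η : E n} (hξ : ξ ∈ tangentCone C x)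
    (hη : η ∈ tangentCone C x) : ξ + η ∈ tangentCone C x := fun d hd => by
  rw [inner_add_right]; exact add_nonpos (hξ d hd) (hη d hd)

theorem isClosed_tangentCone (x : E n) : IsClosed (tangentCone C x) := by
  have : tangentCone C x = ⋂ d ∈ normalCone C x, {ξ | inner ℝ d ξ ≤ 0} := by
    ext; simp [tangentCone]
  rw [this]
  exact isClosed_biInter fun d _ => isClosed_le (by fun_prop) continuous_const

theorem convex_tangentCone (x : E n) : Convex ℝ (tangentCone C x) := by
  intro ξ hξ η hη a b ha hb _ d hd
  rw [inner_add_right, real_inner_smul_right, real_inner_smul_right]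
  exact add_nonpos (mul_nonpos_of_nonneg_of_nonpos ha (hξ d hd))
    (mul_nonpos_of_nonneg_of_nonpos hb (hη d hd))

theorem mem_proj_iff {T : Set (E n)} (hcl : IsClosed T) (hconv : Convex ℝ T) {u v : E n} :
    v ∈ proj T u ↔ v ∈ T ∧ ∀ w ∈ T, inner ℝ (u - v) (w - v) ≤ 0 := by
  rw [proj, mem_ofPred_eq, hcl.closure_eq]
  refine and_congr_right fun hv => ?_
  rw [← norm_eq_iInf_iff_real_inner_le_zero hconv hv, Metric.infDist_eq_iInf]
  simp_rw [dist_eq_norm]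

theorem mem_proj_tangentCone_iff {x u v : E n} : v ∈ proj (tangentCone C x) u ↔
    v ∈ tangentCone C x ∧ ∀ w ∈ tangentCone C x, inner ℝ (u - v) (w - v) ≤ 0 :=
  mem_proj_iff (isClosed_tangentCone x) (convex_tangentCone x)

/-- The projection inequality is tested with `(y - x) + v`, which lies in the tangent cone because
that cone is closed under addition. -/
theorem inner_sub_nonpos_of_mem_proj_tangentCone {x u v y : E n}
    (hv : v ∈ proj (tangentCone C x) u) (hy : y ∈ C) : inner ℝ (u - v) (y - x) ≤ 0 := by
  obtain ⟨hvT, h⟩ := mem_proj_tangentCone_iff.1 hv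
  simpa using h _ (add_mem_tangentCone (sub_mem_tangentCone hy) hvT)

theorem isEquilibrium_iff {xs : E n} : IsEquilibrium F C xs ↔ xs ∈ SOL F C := by
  refine and_congr_right fun hxs => ⟨fun h x hx => ?_, fun h => ?_⟩
  · have := inner_sub_nonpos_of_mem_proj_tangentCone h hx
    rw [sub_zero, inner_neg_left, real_inner_comm] at this
    linarith
  · refine mem_proj_tangentCone_iff.2 ⟨zero_mem_tangentCone xs, fun w hw => ?_⟩
    rw [sub_zero, sub_zero]
    refine hw _ fun x hx => ?_
    rw [inner_neg_left, real_inner_comm]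
    linarith [h x hx]

end Cones

/-! ### Forward invariance. -/

section Invariance

theorem IsSolution.ae_Icc {J : Set ℝ} {x : ℝ → E n} (hx : IsSolution F C J x) {b : ℝ}
    (hb : b ∈ J) :
    ∀ᵐ t, t ∈ Icc 0 b → ∃ v ∈ proj (tangentCone C (x t)) (-F (x t)), HasDerivAt x v t := by
  filter_upwards [hx.ode] with t ht htI
  exact ht (hx.ordConnected.out hx.isLeast.1 hb htI)

theorem forwardInvariant (hcl : IsClosed C) (hconv : Convex ℝ C) : ForwardInvariant F C := by
  intro J x hx hx0 b hb
  have hne : C.Nonempty := ⟨_, hx0⟩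
  have hac : AbsolutelyContinuousOnInterval (fun t => Metric.infDist (x t) C) 0 b :=
    absolutelyContinuousOnInterval_comp (Metric.lipschitz_infDist_pt C)
      (hx.absolutelyContinuous b hb)
  have hle := le_of_ae_hasDerivAt_nonpos (hx.isLeast.2 hb) (hac.fun_mul hac) <| by
    filter_upwards [hx.ae_Icc hb] with t ht htI f' hf'
    obtain ⟨v, hv, hd⟩ := ht htI
    obtain ⟨p, hpC, hp⟩ := hcl.exists_infDist_eq_dist hne (x t)
    have hpproj : p ∈ proj C (x t) := ⟨subset_closure hpC, by rw [hp, dist_eq_norm]⟩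
    have hvar := ((mem_proj_iff hcl hconv).1 hpproj).2
    -- The normal cone is taken at `x t`, possibly outside `C`; moving the base point from `p` to `x
    -- t` only subtracts `‖x t - p‖ ^ 2`.
    have hN : x t - p ∈ normalCone C (x t) := fun y hy => by
      have h1 := hvar y hy
      have h2 : y - x t = (y - p) - (x t - p) := by abel
      rw [h2, inner_sub_right]
      linarith [real_inner_self_nonneg (F := E n) (x := x t - p)]
    have hle := (mem_proj_tangentCone_iff.1 hv).1 _ hN
    have hder := hf'.sub (hasDerivAt_norm_sub_sq hd (hasDerivAt_const t p))
    -- With `p` frozen, `‖x s - p‖ ^ 2` dominates the squared distance and touches it at `s = t`, so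
    -- the two derivatives agree there.
    have hmax : IsLocalMax ((fun s => Metric.infDist (x s) C * Metric.infDist (x s) C) -
        fun s => ‖x s - p‖ ^ 2) t := by
      refine Filter.Eventually.of_forall fun s => ?_
      have h1 : Metric.infDist (x s) C ≤ ‖x s - p‖ :=
        (Metric.infDist_le_dist_of_mem hpC).trans_eq (dist_eq_norm _ _)
      have h2 : Metric.infDist (x t) C = ‖x t - p‖ := by rw [hp, dist_eq_norm]
      have h3 := mul_self_le_mul_self Metric.infDist_nonneg h1
      simp only [Pi.sub_apply, h2]
      nlinarith
    have h0 := hmax.hasDerivAt_eq_zero hder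
    rw [sub_zero] at h0
    linarith
  rw [Metric.infDist_zero_of_mem hx0, mul_zero] at hle
  have h0 : Metric.infDist (x b) C = 0 :=
    mul_self_eq_zero.1 (le_antisymm hle (mul_self_nonneg _))
  rwa [hcl.mem_iff_infDist_zero hne]

end Invariance

/-! ### Contraction, uniqueness and stability. -/

section Contraction

/-- Two solutions along which `F` is monotone with modulus `κ` approach each other at rate `κ`. -/
theorem IsSolution.norm_sub_le {J : Set ℝ} {x y : ℝ → E n} (hcl : IsClosed C)
    (hconv : Convex ℝ C) (hx : IsSolution F C J x) (hy : IsSolution F C J y) (hx0 : x 0 ∈ C)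
    (hy0 : y 0 ∈ C) {b κ : ℝ} (hb : b ∈ J)
    (hκ : ∀ t ∈ Icc 0 b, κ * ‖x t - y t‖ ^ 2 ≤ inner ℝ (x t - y t) (F (x t) - F (y t))) :
    ‖x b - y b‖ ≤ Real.exp (-κ * b) * ‖x 0 - y 0‖ := by
  have hac : AbsolutelyContinuousOnInterval (fun t => ‖x t - y t‖) 0 b :=
    absolutelyContinuousOnInterval_comp lipschitzWith_one_norm
      ((hx.absolutelyContinuous b hb).fun_sub (hy.absolutelyContinuous b hb))
  have hle := le_exp_mul_of_ae_hasDerivAt_le (κ := 2 * κ) (hx.isLeast.2 hb)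
    (f := fun t => ‖x t - y t‖ ^ 2) (by simpa only [sq] using hac.fun_mul hac) <| by
    filter_upwards [hx.ae_Icc hb, hy.ae_Icc hb] with t htx hty htI
    obtain ⟨v, hv, hvd⟩ := htx htI
    obtain ⟨w, hw, hwd⟩ := hty htI
    refine ⟨_, hasDerivAt_norm_sub_sq hvd hwd, ?_⟩
    have htJ := hx.ordConnected.out hx.isLeast.1 hb htI
    have h1 := inner_sub_nonpos_of_mem_proj_tangentCone hv
      (forwardInvariant hcl hconv J y hy hy0 t htJ)
    have h2 := inner_sub_nonpos_of_mem_proj_tangentCone hw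
      (forwardInvariant hcl hconv J x hx hx0 t htJ)
    have h3 := hκ t htI
    rw [← neg_sub (x t) (y t), inner_neg_right, real_inner_comm] at h1
    rw [real_inner_comm] at h2
    simp only [inner_sub_right, inner_neg_right] at h1 h2 h3 ⊢
    linarith
  refine le_of_sq_le_sq ?_ (by positivity)
  rw [mul_pow, ← Real.exp_nat_mul]
  rw [show ((2 : ℕ) : ℝ) * (-κ * b) = -(2 * κ) * b by push_cast; ring]
  exact hle

theorem contracting_of_forall_le (hcl : IsClosed C) (hconv : Convex ℝ C) {κ : ℝ}
    (h : ∀ x₁ x₂, κ * ‖x₁ - x₂‖ ^ 2 ≤ inner ℝ (x₁ - x₂) (F x₁ - F x₂)) : Contracting F C κ :=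
  fun _ _ _ hx hy hx0 hy0 _ ht => hx.norm_sub_le hcl hconv hy hx0 hy0 ht fun _ _ => h _ _

theorem IsSolution.eqOn (hcl : IsClosed C) (hconv : Convex ℝ C) (hF : ContDiff ℝ 1 F)
    {J : Set ℝ} {x y : ℝ → E n} (hx : IsSolution F C J x) (hy : IsSolution F C J y)
    (hx0 : x 0 ∈ C) (h0 : x 0 = y 0) {b : ℝ} (hb : b ∈ J) : x b = y b := by
  obtain ⟨R₁, hR₁⟩ := (hx.absolutelyContinuous b hb).exists_bound
  obtain ⟨R₂, hR₂⟩ := (hy.absolutelyContinuous b hb).exists_bound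
  obtain ⟨L, hL⟩ := hF.contDiffOn.exists_lipschitzOnWith (s := Metric.closedBall 0 (max R₁ R₂))
    one_ne_zero (convex_closedBall _ _) (isCompact_closedBall _ _)
  -- A Lipschitz constant `L` on a ball containing both trajectories is monotonicity with modulus
  -- `-L`, and the initial distance is zero.
  have hle := hx.norm_sub_le hcl hconv hy hx0 (h0 ▸ hx0) hb (κ := -L) fun t ht => by
    rw [← uIcc_of_le (hx.isLeast.2 hb)] at ht
    have h1 := hL.dist_le_mul (x t) (by simpa using .inl (hR₁ t ht)) (y t)
      (by simpa using .inr (hR₂ t ht))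
    rw [dist_eq_norm, dist_eq_norm] at h1
    have h2 := neg_le_of_abs_le (abs_real_inner_le_norm (x t - y t) (F (x t) - F (y t)))
    have h3 := mul_le_mul_of_nonneg_left h1 (norm_nonneg (x t - y t))
    linarith
  rw [h0, sub_self, norm_zero, mul_zero] at hle
  exact sub_eq_zero.1 (norm_le_zero_iff.1 hle)

theorem isSolution_const {J : Set ℝ} (hJ : J.OrdConnected) (h0 : IsLeast J 0) {xs : E n}
    (hxs : xs ∈ SOL F C) : IsSolution F C J fun _ => xs where
  ordConnected := hJ
  isLeast := h0
  absolutelyContinuous _ _ :=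
    ((LipschitzWith.const xs).lipschitzOnWith (K := 0)).absolutelyContinuousOnInterval
  ode := .of_forall fun t _ => ⟨0, (isEquilibrium_iff.2 hxs).2, hasDerivAt_const t xs⟩

theorem Contracting.norm_sub_le {κ : ℝ} (hκ : Contracting F C κ) {xs : E n}
    (hxs : xs ∈ SOL F C) {J : Set ℝ} {x : ℝ → E n} (hx : IsSolution F C J x) (hx0 : x 0 ∈ C)
    {t : ℝ} (ht : t ∈ J) : ‖x t - xs‖ ≤ Real.exp (-κ * t) * ‖x 0 - xs‖ :=
  hκ J x _ hx (isSolution_const hx.ordConnected hx.isLeast hxs) hx0 hxs.1 t ht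

theorem Contracting.globallyLyapunovStable (h : Contracting F C 0) {xs : E n}
    (hxs : xs ∈ SOL F C) : GloballyLyapunovStable F C xs := by
  have key : ∀ δ > 0, ∀ (J : Set ℝ) (x : ℝ → E n), IsSolution F C J x → x 0 ∈ C →
      ‖x 0 - xs‖ < δ → ∀ t ∈ J, ‖x t - xs‖ < δ := fun δ _ J x hx hx0 hδ t ht => by
    refine lt_of_le_of_lt ?_ hδ
    simpa using h.norm_sub_le hxs hx hx0 ht
  exact ⟨fun ε hε => ⟨ε, hε, key ε hε⟩, fun δ hδ => ⟨δ, hδ, key δ hδ⟩⟩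

theorem Contracting.globallyExponentiallyStable {μ : ℝ} (hμ : 0 < μ) (h : Contracting F C μ)
    {xs : E n} (hxs : xs ∈ SOL F C) : GloballyExponentiallyStable F C xs μ :=
  ⟨hμ, 1, one_pos, fun J x hx hx0 t ht => by
    rw [one_mul]; exact h.norm_sub_le hxs hx hx0 ht⟩

theorem StronglyMonotoneMap.subsingleton_SOL {μ : ℝ} (hF : StronglyMonotoneMap μ F) :
    (SOL F C).Subsingleton := by
  intro x hx y hy
  have h1 := hx.2 y hy.1
  have h2 := hy.2 x hx.1
  have h3 := hF.2 x y
  rw [← neg_sub x y, inner_neg_left] at h1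
  rw [inner_sub_right] at h3
  have h4 : ‖x - y‖ ^ 2 ≤ 0 := nonpos_of_mul_nonpos_right (by linarith) hF.1
  exact sub_eq_zero.1 (norm_eq_zero.1 (pow_eq_zero_iff two_ne_zero |>.1
    (le_antisymm h4 (sq_nonneg _))))

end Contraction

/-! ### Local and global existence. -/

section Existence

/-- This is Moreau's decomposition: `-F x - v` is normal, and `v` is orthogonal to every normal,
hence tangent, so `v` is the projection of `-F x`. -/
theorem isSolution_of_variational {J : Set ℝ} (hJ : J.OrdConnected) (h0 : IsLeast J 0)
    {x : ℝ → E n} {M : NNReal} (hx : LipschitzWith M x) (hxC : ∀ t, x t ∈ C)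
    (hvar : ∀ t ∈ J, ∀ v, HasDerivAt x v t → ∀ z ∈ C, 0 ≤ inner ℝ (v + F (x t)) (z - x t)) :
    IsSolution F C J x where
  ordConnected := hJ
  isLeast := h0
  absolutelyContinuous _ _ := hx.lipschitzOnWith.absolutelyContinuousOnInterval
  ode := by
    filter_upwards [hx.ae_differentiableAt_real] with t hd ht
    have hv := hd.hasDerivAt
    refine ⟨_, mem_proj_tangentCone_iff.2 ?_, hv⟩
    -- The curve stays in `C` on both sides of `t`, so `⟪d, x s - x t⟫` is maximal at `s = t`.
    have hzero : ∀ d ∈ normalCone C (x t), inner ℝ d (deriv x t) = 0 := fun d hd => by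
      have hder : HasDerivAt (fun s => inner ℝ d (x s - x t)) (inner ℝ d (deriv x t)) t := by
        simpa using (hasDerivAt_const t d).inner ℝ (hv.sub_const (x t))
      refine IsLocalMax.hasDerivAt_eq_zero (Filter.Eventually.of_forall fun s => ?_) hder
      simpa using hd _ (hxC s)
    have hN : -F (x t) - deriv x t ∈ normalCone C (x t) := fun z hz => by
      have := hvar t ht _ hv z hz
      rw [← neg_add', add_comm, inner_neg_left]
      linarith
    refine ⟨fun d hd => (hzero d hd).le, fun w hw => ?_⟩
    rw [inner_sub_right, hzero _ hN, sub_zero]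
    exact hw _ hN

/-- The variational inequality over a truncation of `C` extends to `C` at interior points of the
ball. -/
theorem variational_of_inter_closedBall (hconv : Convex ℝ C) {p x d : E n} {R : ℝ} (hx : x ∈ C)
    (hxR : ‖x - p‖ < R) (h : ∀ z ∈ C ∩ Metric.closedBall p R, 0 ≤ inner ℝ d (z - x)) :
    ∀ z ∈ C, 0 ≤ inner ℝ d (z - x) := by
  intro z hz
  -- A short enough step from `x` towards `z` stays in the ball, and the inequality scales with the
  -- step length.
  have hcont : Tendsto (fun ε : ℝ => ‖x + ε • (z - x) - p‖) (𝓝[>] 0)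
      (𝓝 ‖x + (0 : ℝ) • (z - x) - p‖) :=
    (Continuous.tendsto (by fun_prop) 0).mono_left nhdsWithin_le_nhds
  obtain ⟨ε, hlt, hε0, hε1⟩ := ((hcont.eventually_lt_const (by simpa using hxR)).and
    (Ioo_mem_nhdsGT (zero_lt_one (α := ℝ)))).exists
  have hmem : x + ε • (z - x) ∈ C := hconv.add_smul_sub_mem hx hz ⟨hε0.le, hε1.le⟩
  have := h _ ⟨hmem, by rw [Metric.mem_closedBall, dist_eq_norm]; exact hlt.le⟩
  rw [add_sub_cancel_left, real_inner_smul_right] at this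
  exact nonneg_of_mul_nonneg_right this hε0

/-- Solutions of the evolution variational inequality in a truncation of `C`. -/
theorem exists_truncated_solution (hcl : IsClosed C) (hconv : Convex ℝ C) (hF : Continuous F)
    {x₀ p : E n} (hx₀ : x₀ ∈ C) {R : ℝ} (hR : ‖x₀ - p‖ ≤ R) :
    ∃ (M : NNReal) (x : ℝ → E n), LipschitzWith M x ∧ x 0 = x₀ ∧ (∀ t, x t ∈ C) ∧
      ∀ t, 0 ≤ t → ∀ v, HasDerivAt x v t →
        ∀ z ∈ C ∩ Metric.closedBall p R, 0 ≤ inner ℝ (v + F (x t)) (z - x t) := by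
  have hK : IsCompact (C ∩ Metric.closedBall p R) := (isCompact_closedBall p R).inter_left hcl
  obtain ⟨M, hM⟩ := hK.exists_bound_of_continuousOn hF.continuousOn
  obtain ⟨x, hL, h0, hxK, hvar⟩ := exists_lipschitz_variational_solution hK
    (hconv.inter (convex_closedBall p R)) hF (x₀ := x₀)
    ⟨hx₀, by rwa [Metric.mem_closedBall, dist_eq_norm]⟩ (M := M.toNNReal)
    fun y hy => (hM y hy).trans (Real.le_coe_toNNReal M)
  exact ⟨_, x, hL, h0, fun t => (hxK t).1, hvar⟩

theorem exists_local_solution (hcl : IsClosed C) (hconv : Convex ℝ C) (hF : Continuous F)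
    {x₀ : E n} (hx₀ : x₀ ∈ C) :
    ∃ T > 0, ∃ x : ℝ → E n, IsSolution F C (Ico 0 T) x ∧ x 0 = x₀ := by
  obtain ⟨M, x, hL, h0, hxC, hvar⟩ := exists_truncated_solution hcl hconv hF hx₀ (p := x₀)
    (R := 1) (by simp)
  -- At speed at most `M`, the curve stays strictly inside the unit ball before this time.
  have hT : (0 : ℝ) < ((M : ℝ) + 1)⁻¹ := by positivity
  refine ⟨_, hT, x, isSolution_of_variational ordConnected_Ico (isLeast_Ico hT) hL hxC ?_, h0⟩
  intro t ht v hv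
  refine variational_of_inter_closedBall hconv (hxC t) ?_ (hvar t ht.1 v hv)
  have h1 := hL.dist_le_mul t 0
  rw [h0, dist_eq_norm, Real.dist_eq, sub_zero, abs_of_nonneg ht.1] at h1
  refine h1.trans_lt ?_
  have h2 : (M + 1) * t < 1 := by
    have := mul_lt_mul_of_pos_left ht.2 (show (0 : ℝ) < M + 1 by positivity)
    rwa [mul_inv_cancel₀ (by positivity)] at this
  linarith [ht.1]

theorem globallySolvable (hcl : IsClosed C) (hconv : Convex ℝ C) (hF : Continuous F)
    (hmono : MonotoneMap F) (hSOL : (SOL F C).Nonempty) : GloballySolvable F C := by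
  obtain ⟨xs, hxs⟩ := hSOL
  intro x₀ hx₀
  obtain ⟨M, x, hL, h0, hxC, hvar⟩ := exists_truncated_solution hcl hconv hF hx₀ (p := xs)
    (R := ‖x₀ - xs‖ + 1) (by simp)
  -- Testing with `xs` and using monotonicity, the distance to `xs` never grows; the extra `1` in
  -- the radius keeps the curve strictly inside the ball.
  have hbound : ∀ b, 0 ≤ b → ‖x b - xs‖ ≤ ‖x₀ - xs‖ := fun b hb => by
    have hac : AbsolutelyContinuousOnInterval (fun t => ‖x t - xs‖) 0 b :=
      absolutelyContinuousOnInterval_comp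
        (lipschitzWith_one_norm.comp (LipschitzWith.id.sub (LipschitzWith.const xs)) |>.weaken
          (by simp)) hL.lipschitzOnWith.absolutelyContinuousOnInterval
    have hle := le_of_ae_hasDerivAt_nonpos hb (hac.fun_mul hac) <| by
      filter_upwards [hL.ae_differentiableAt_real] with t hd ht f' hf'
      have hv := hd.hasDerivAt
      simp only [← sq] at hf'
      rw [hf'.unique (hasDerivAt_norm_sub_sq hv (hasDerivAt_const t xs))]
      have h1 := hvar t ht.1 _ hv xs ⟨hxs.1, Metric.mem_closedBall_self (by positivity)⟩
      have h2 := hmono (x t) xs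
      have h3 := hxs.2 _ (hxC t)
      rw [← neg_sub (x t) xs, inner_neg_right, inner_add_left, real_inner_comm,
        real_inner_comm _ (F (x t))] at h1
      rw [inner_sub_right] at h2
      rw [sub_zero]
      linarith
    rw [h0] at hle
    exact le_of_sq_le_sq (by simpa only [sq] using hle) (norm_nonneg _)
  refine ⟨x, isSolution_of_variational ordConnected_Ici isLeast_Ici hL hxC ?_, h0⟩
  intro t ht v hv
  exact variational_of_inter_closedBall hconv (hxC t)
    ((hbound t ht).trans_lt (lt_add_one _)) (hvar t ht v hv)

end Existence

theorem isClosed_constraintSet {m k : ℕ} {g : E n → E m} {h : E n → E k} (hg : Continuous g)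
    (hh : Continuous h) : IsClosed (constraintSet g h) := by
  have : constraintSet g h = (⋂ i, {x | g x i ≤ 0}) ∩ {x | h x = 0} := by
    ext; simp [constraintSet]
  rw [this]
  exact (isClosed_iInter fun i => isClosed_le (by fun_prop) continuous_const).inter
    (isClosed_eq hh continuous_const)

theorem continuous_affineConstraint {k : ℕ} (H : Matrix (Fin k) (Fin n) ℝ) (c : E k) :
    Continuous (affineConstraint H c) :=
  ((PiLp.continuous_toLp 2 _).comp
    (Continuous.matrix_mulVec continuous_const (PiLp.continuous_ofLp 2 _))).sub continuous_const

end ProjFlow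

theorem mainTheorem9 {n m k : ℕ}
    (F : ProjFlow.E n → ProjFlow.E n) (hF : ContDiff ℝ 1 F)
    (g : ProjFlow.E n → ProjFlow.E m) (hg : ContDiff ℝ 1 g)
    (H : Matrix (Fin k) (Fin n) ℝ) (c : ProjFlow.E k)
    (C : Set (ProjFlow.E n))
    (hC : C = ProjFlow.constraintSet g (ProjFlow.affineConstraint H c))
    (hconv : Convex ℝ C)
    (hSOL : (ProjFlow.SOL F C).Nonempty)
    (hMFCQ : ∀ x ∈ C, ProjFlow.MFCQ g (ProjFlow.affineConstraint H c) x) :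
    -- the flow is well posed on `C`, and complete if `F` is monotone
    (ProjFlow.WellPosed F C ∧ (ProjFlow.MonotoneMap F → ProjFlow.GloballySolvable F C)) ∧
    -- (i)
    ProjFlow.ForwardInvariant F C ∧
    -- (ii)
    (∀ xs, ProjFlow.IsEquilibrium F C xs ↔ xs ∈ ProjFlow.SOL F C) ∧
    -- (iii)
    (ProjFlow.MonotoneMap F → ∀ xs ∈ ProjFlow.SOL F C, ProjFlow.GloballyLyapunovStable F C xs) ∧
    -- (iv)
    (∀ μ : ℝ, ProjFlow.StronglyMonotoneMap μ F →
      ProjFlow.Contracting F C μ ∧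
      ∃ xs, ProjFlow.SOL F C = {xs} ∧ ProjFlow.GloballyExponentiallyStable F C xs μ) := by
  have hcl : IsClosed C := hC ▸ ProjFlow.isClosed_constraintSet hg.continuous
    (ProjFlow.continuous_affineConstraint H c)
  refine ⟨⟨⟨fun x₀ hx₀ => ProjFlow.exists_local_solution hcl hconv hF.continuous hx₀,
    fun J x y hx hy hx0 h0 t ht => hx.eqOn hcl hconv hF hy hx0 h0 ht⟩,
    fun hm => ProjFlow.globallySolvable hcl hconv hF.continuous hm hSOL⟩,
    ProjFlow.forwardInvariant hcl hconv, fun xs => ProjFlow.isEquilibrium_iff,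
    fun hm xs hxs => ProjFlow.Contracting.globallyLyapunovStable
      (ProjFlow.contracting_of_forall_le hcl hconv fun x₁ x₂ => by simpa using hm x₁ x₂) hxs,
    fun μ hμ => ?_⟩
  have hcontr := ProjFlow.contracting_of_forall_le hcl hconv hμ.2
  obtain ⟨xs, hxs⟩ := hSOL
  exact ⟨hcontr, xs, hμ.subsingleton_SOL.eq_singleton_of_mem hxs,
    hcontr.globallyExponentiallyStable hμ.1 hxs⟩
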